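/- **Proposition 3.1.** Let $M$ be a connected smooth manifold of even dimension $n\ge 4$, let $g$ be a smooth Riemannian metric on $M$ which is Kähler with respect to some complex structure $J$ on $M$, and let $f,\lambda:M\to\mathbb R$ be smooth functions such that $(g,f)$ is a gradient Ricci almost soliton pair with metric coefficient $\lambda$, i.e. $$\mathrm{Ric}+\nabla df=\lambda\, g ,$$ where $\mathrm{Ric}$ is the Ricci tensor of $g$ and $\nabla df$ is the $g$-Hessian of $f$. Then $\lambda$ is constant; that is, there is $c\in\mathbb R$ with $\lambda\equiv c$ and $\mathrm{Ric}+\nabla df=c\,g$, so that $(g,f)$ is a gradient Kähler–Ricci soliton. Here $J$ is a complex structure if it is a smooth field of endomorphisms of the tangent spaces with $J^2=-\mathrm{Id}$ and vanishing Nijenhuis tensor, and $g$ is Kähler with respect to $J$ if $g(J\cdot,J\cdot)=g$ and the 2-form $\omega=g(J\cdot,\cdot)$ is closed. -/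

import Mathlib

open scoped Manifold ContDiff

noncomputable section

/-! ### Tensor calculus in an open set of `ℝⁿ`

Indices run over `Fin n`.  The components `G i j` of a Riemannian metric, as functions of the
coordinates, are collected in a matrix-valued function `G`. -/

namespace Coord

variable {n : ℕ}

/-- The partial derivative `∂ᵢ u` at `y`. -/
def pd (i : Fin n) (u : EuclideanSpace ℝ (Fin n) → ℝ) (y : EuclideanSpace ℝ (Fin n)) : ℝ :=
  fderiv ℝ u y (EuclideanSpace.single i 1)

/-- The Christoffel symbols of the Levi-Civita connection,
`Γᵏᵢⱼ = ½ ∑ₗ gᵏˡ (∂ᵢ gⱼₗ + ∂ⱼ gᵢₗ - ∂ₗ gᵢⱼ)`, so that `∇_{∂ᵢ} ∂ⱼ = ∑ₖ Γᵏᵢⱼ ∂ₖ`. -/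
def christoffel (G : EuclideanSpace ℝ (Fin n) → Matrix (Fin n) (Fin n) ℝ) (k i j : Fin n)
    (y : EuclideanSpace ℝ (Fin n)) : ℝ :=
  (1 / 2) * ∑ l, (G y)⁻¹ k l *
    (pd i (fun z ↦ G z j l) y + pd j (fun z ↦ G z i l) y - pd l (fun z ↦ G z i j) y)

/-- The curvature components `Rˡᵢⱼₖ`, where `R(∂ᵢ, ∂ⱼ) ∂ₖ = ∑ₗ Rˡᵢⱼₖ ∂ₗ` and
`R(X, Y) Z = ∇_X ∇_Y Z - ∇_Y ∇_X Z - ∇_{[X, Y]} Z`. -/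
def riemann (G : EuclideanSpace ℝ (Fin n) → Matrix (Fin n) (Fin n) ℝ) (l i j k : Fin n)
    (y : EuclideanSpace ℝ (Fin n)) : ℝ :=
  pd i (christoffel G l j k) y - pd j (christoffel G l i k) y
    + ∑ m, (christoffel G l i m y * christoffel G m j k y
      - christoffel G l j m y * christoffel G m i k y)

/-- The Ricci tensor `Ric(∂ⱼ, ∂ₖ)`, the trace of `X ↦ R(X, ∂ⱼ) ∂ₖ`. -/
def ricci (G : EuclideanSpace ℝ (Fin n) → Matrix (Fin n) (Fin n) ℝ) (j k : Fin n)
    (y : EuclideanSpace ℝ (Fin n)) : ℝ :=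
  ∑ i, riemann G i i j k y

/-- The Hessian `(∇du)(∂ᵢ, ∂ⱼ) = ∂ᵢ ∂ⱼ u - ∑ₖ Γᵏᵢⱼ ∂ₖ u`. -/
def hessian (G : EuclideanSpace ℝ (Fin n) → Matrix (Fin n) (Fin n) ℝ)
    (u : EuclideanSpace ℝ (Fin n) → ℝ) (i j : Fin n) (y : EuclideanSpace ℝ (Fin n)) : ℝ :=
  pd i (pd j u) y - ∑ k, christoffel G k i j y * pd k u y

/-- The component along `∂ₖ` of the Nijenhuis tensor
`N(X, Y) = [AX, AY] - A[AX, Y] - A[X, AY] + A²[X, Y]` evaluated on `∂ᵢ, ∂ⱼ`, for the field of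
endomorphisms `A ∂ⱼ = ∑ₖ Aᵏⱼ ∂ₖ`, where `Aᵏⱼ` is the matrix entry `A k j`. -/
def nijenhuis (A : EuclideanSpace ℝ (Fin n) → Matrix (Fin n) (Fin n) ℝ) (k i j : Fin n)
    (y : EuclideanSpace ℝ (Fin n)) : ℝ :=
  ∑ l, (A y l i * pd l (fun z ↦ A z k j) y - A y l j * pd l (fun z ↦ A z k i) y
    - A y k l * (pd i (fun z ↦ A z l j) y - pd j (fun z ↦ A z l i) y))

/-- The component `(dω)(∂ᵢ, ∂ⱼ, ∂ₖ)` of the exterior derivative of a 2-form `ω`. -/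
def extDerivTwo (w : EuclideanSpace ℝ (Fin n) → Matrix (Fin n) (Fin n) ℝ) (i j k : Fin n)
    (y : EuclideanSpace ℝ (Fin n)) : ℝ :=
  pd i (fun z ↦ w z j k) y + pd j (fun z ↦ w z k i) y + pd k (fun z ↦ w z i j) y

end Coord

/-! ### Components of tensor fields on a manifold in a chart -/

section Manifold

variable {n : ℕ} {M : Type*} [TopologicalSpace M] [ChartedSpace (EuclideanSpace ℝ (Fin n)) M]

/-- The coordinate vector `∂ᵢ` of the chart `e`, at the point with coordinates `y`. -/
def coordVec (e : OpenPartialHomeomorph M (EuclideanSpace ℝ (Fin n)))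
    (y : EuclideanSpace ℝ (Fin n)) (i : Fin n) : TangentSpace (𝓡 n) (e.symm y) :=
  mfderiv (𝓡 n) (𝓡 n) e.symm y ((NormedSpace.fromTangentSpace y).symm (EuclideanSpace.single i 1))

/-- The components of a tangent vector with respect to the coordinate vectors of the chart `e`. -/
def vecComp (e : OpenPartialHomeomorph M (EuclideanSpace ℝ (Fin n))) {p : M}
    (v : TangentSpace (𝓡 n) p) : EuclideanSpace ℝ (Fin n) :=
  NormedSpace.fromTangentSpace (e p) (mfderiv (𝓡 n) (𝓡 n) e p v)

/-- A smooth Riemannian metric on `M`. -/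
abbrev SmoothMetric (n : ℕ) (M : Type*) [TopologicalSpace M]
    [ChartedSpace (EuclideanSpace ℝ (Fin n)) M] [IsManifold (𝓡 n) ∞ M] : Type _ :=
  Bundle.ContMDiffRiemannianMetric (𝓡 n) ∞ (EuclideanSpace ℝ (Fin n))
    (TangentSpace (𝓡 n) : M → Type _)

/-- The components `Jᵏⱼ` (row `k`, column `j`) in the chart `e` of a field of endomorphisms of the
tangent spaces: `J ∂ⱼ = ∑ₖ Jᵏⱼ ∂ₖ`. -/
def endoComp (J : ∀ p : M, TangentSpace (𝓡 n) p →L[ℝ] TangentSpace (𝓡 n) p)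
    (e : OpenPartialHomeomorph M (EuclideanSpace ℝ (Fin n)))
    (y : EuclideanSpace ℝ (Fin n)) : Matrix (Fin n) (Fin n) ℝ :=
  Matrix.of fun k j ↦ vecComp e (J (e.symm y) (coordVec e y j)) k

variable [IsManifold (𝓡 n) ∞ M]

/-- The components `g(∂ᵢ, ∂ⱼ)` in the chart `e`. -/
def metricComp (g : SmoothMetric n M) (e : OpenPartialHomeomorph M (EuclideanSpace ℝ (Fin n)))
    (y : EuclideanSpace ℝ (Fin n)) : Matrix (Fin n) (Fin n) ℝ :=
  Matrix.of fun i j ↦ g.inner (e.symm y) (coordVec e y i) (coordVec e y j)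

/-- The components `ω(∂ᵢ, ∂ⱼ)` in the chart `e` of `ω = g(J ·, ·)`. -/
def kahlerFormComp (g : SmoothMetric n M)
    (J : ∀ p : M, TangentSpace (𝓡 n) p →L[ℝ] TangentSpace (𝓡 n) p)
    (e : OpenPartialHomeomorph M (EuclideanSpace ℝ (Fin n)))
    (y : EuclideanSpace ℝ (Fin n)) : Matrix (Fin n) (Fin n) ℝ :=
  Matrix.of fun i j ↦
    g.inner (e.symm y) (J (e.symm y) (coordVec e y i)) (coordVec e y j)

/-- `J` is a complex structure on `M`: a smooth almost complex structure whose Nijenhuis tensor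
vanishes. -/
structure IsComplexStructure
    (J : ∀ p : M, TangentSpace (𝓡 n) p →L[ℝ] TangentSpace (𝓡 n) p) : Prop where
  smooth : ContMDiff (𝓡 n)
    ((𝓡 n).prod 𝓘(ℝ, EuclideanSpace ℝ (Fin n) →L[ℝ] EuclideanSpace ℝ (Fin n))) ∞
    (fun p ↦ (Bundle.TotalSpace.mk' (EuclideanSpace ℝ (Fin n) →L[ℝ] EuclideanSpace ℝ (Fin n))
      (E := fun p : M ↦ TangentSpace (𝓡 n) p →L[ℝ] TangentSpace (𝓡 n) p) p (J p)))
  sq : ∀ (p : M) (v : TangentSpace (𝓡 n) p), J p (J p v) = -v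
  integrable : ∀ e ∈ atlas (EuclideanSpace ℝ (Fin n)) M, ∀ y ∈ e.target, ∀ k i j,
    Coord.nijenhuis (endoComp J e) k i j y = 0

/-- `g` is a Kähler metric with respect to the complex structure `J`: it is hermitian and its
Kähler form is closed. -/
structure IsKahler (g : SmoothMetric n M)
    (J : ∀ p : M, TangentSpace (𝓡 n) p →L[ℝ] TangentSpace (𝓡 n) p) : Prop where
  isComplex : IsComplexStructure J
  hermitian : ∀ (p : M) (v w : TangentSpace (𝓡 n) p),
    g.inner p (J p v) (J p w) = g.inner p v w
  closed : ∀ e ∈ atlas (EuclideanSpace ℝ (Fin n)) M, ∀ y ∈ e.target, ∀ i j k,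
    Coord.extDerivTwo (kahlerFormComp g J e) i j k y = 0

/-- `(g, f)` is a gradient Ricci almost soliton pair with metric coefficient `lam`: the functions
`f` and `lam` are smooth and `Ric + ∇df = lam g`. -/
structure IsGradientRicciAlmostSoliton (g : SmoothMetric n M) (f lam : M → ℝ) : Prop where
  smooth_f : ContMDiff (𝓡 n) 𝓘(ℝ) ∞ f
  smooth_lam : ContMDiff (𝓡 n) 𝓘(ℝ) ∞ lam
  eqn : ∀ e ∈ atlas (EuclideanSpace ℝ (Fin n)) M, ∀ y ∈ e.target, ∀ i j,
    Coord.ricci (metricComp g e) i j y + Coord.hessian (metricComp g e) (f ∘ e.symm) i j y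
      = lam (e.symm y) * metricComp g e y i j

/-- `(g, f)` is a gradient Ricci soliton pair: the metric coefficient is a constant `c`. -/
def IsGradientRicciSoliton (g : SmoothMetric n M) (f : M → ℝ) (c : ℝ) : Prop :=
  IsGradientRicciAlmostSoliton g f (fun _ ↦ c)

/-- `(g, f)` is a gradient Kähler–Ricci soliton with respect to `J`: a gradient Ricci soliton
whose metric is Kähler. -/
def IsGradientKahlerRicciSoliton (g : SmoothMetric n M)
    (J : ∀ p : M, TangentSpace (𝓡 n) p →L[ℝ] TangentSpace (𝓡 n) p) (f : M → ℝ) (c : ℝ) : Prop :=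
  IsKahler g J ∧ IsGradientRicciSoliton g f c

end Manifold

end

/-! Composing `Ric + ∇df = λ g` with `J` and taking the skew part turns it into an identity of
2-forms, with `2λ g(·, J·)` on one side. Since `J` is parallel, the other side is closed: the skew
part of `Ric ∘ J` is `-tr (J R(·, ·))` (`ric_mul_sub`), closed by the second Bianchi identity
(`trace_mul_curv_closed`), and the skew part of `∇df ∘ J` is the exact form `d(df ∘ J)`
(`hess_mul_sub`). As `g(·, J·)` is itself closed, `dλ ∧ g(·, J·) = 0`. Contracting with the inverse
of this nondegenerate form gives `(n - 2) dλ = 0` (`eq_zero_of_wedge_eq_zero`), so `dλ = 0` when `n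
≥ 4`, and connectedness makes `λ` constant.

That `J` is parallel has to be derived from `N = 0` and `dω = 0` (`complexStructure_parallel`).

The local argument is pure algebra: it takes place in matrices over a commutative ℝ-algebra with
commuting derivations, later specialised to the smooth functions on a chart target. The matrix `Γ i`
has entry `Γᵏᵢⱼ` in row `k`, column `j`, so that `∇ᵢ = ∂ᵢ + Γ i` on vector fields. -/

noncomputable section

/-! ### Matrices over a commutative ring with commuting derivations -/

namespace DiffMatrix

variable {ι R : Type*} [CommRing R]

/-- A 1-form whose product with a nondegenerate 2-form vanishes is zero in dimension other
than 2. -/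
lemma eq_zero_of_wedge_eq_zero [Fintype ι] [DecidableEq ι] {W V : Matrix ι ι R}
    (hW : W.transpose = -W) (hWV : W * V = 1) {l : ι → R} (h : ∀ i j k, l k * W i j + l i * W j k + l j * W k i = 0) (i : ι) :
    ((Fintype.card ι : R) - 2) * l i = 0 := by
  have hV : V.transpose = -V := by
    have h1 : V.transpose * W = -1 := by
      rw [← neg_neg W, ← hW, mul_neg, ← Matrix.transpose_mul, hWV, Matrix.transpose_one]
    calc V.transpose = V.transpose * W * V := by rw [Matrix.mul_assoc, hWV, mul_one]
      _ = -V := by rw [h1, neg_mul, one_mul]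
  -- Contracting the hypothesis with `V k j` turns its three terms into `card ι * l i`, `-l i` and
  -- `-l i`.
  have e1 : ∑ j, ∑ k, l i * W j k * V k j = Fintype.card ι * l i := by
    simp only [mul_assoc, ← Finset.mul_sum, ← Matrix.mul_apply, hWV]
    simp [mul_comm]
  have e2 : ∑ j, ∑ k, l k * W i j * V k j = - l i := by
    rw [Finset.sum_comm]
    have (k j : ι) : l k * W i j * V k j = - (l k * (W i j * V j k)) := by
      rw [show V k j = - V j k from congrFun₂ hV j k]; ring
    simp only [this, Finset.sum_neg_distrib, ← Finset.mul_sum, ← Matrix.mul_apply, hWV]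
    simp [Matrix.one_apply]
  have e3 : ∑ j, ∑ k, l j * W k i * V k j = - l i := by
    have (k j : ι) : l j * W k i * V k j = - (l j * (W i k * V k j)) := by
      rw [show W k i = - W i k from congrFun₂ hW i k]; ring
    simp only [this, Finset.sum_neg_distrib, ← Finset.mul_sum, ← Matrix.mul_apply, hWV]
    simp [Matrix.one_apply]
  have : ∑ j, ∑ k, (l k * W i j + l i * W j k + l j * W k i) * V k j = 0 := by simp [h]
  simp only [add_mul, Finset.sum_add_distrib, e1, e2, e3] at this
  linear_combination this

variable [Algebra ℝ R]

/-- The entrywise application of a derivation to a matrix. -/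
def matDeriv (D : Derivation ℝ R R) : Matrix ι ι R →ₗ[ℝ] Matrix ι ι R :=
  D.toLinearMap.mapMatrix

@[simp] lemma matDeriv_apply (D : Derivation ℝ R R) (A : Matrix ι ι R) (a b : ι) :
    matDeriv D A a b = D (A a b) := rfl

lemma matDeriv_transpose (D : Derivation ℝ R R) (A : Matrix ι ι R) :
    matDeriv D A.transpose = (matDeriv D A).transpose := rfl

lemma matDeriv_comm {D E : Derivation ℝ R R} (h : ∀ a, D (E a) = E (D a)) (A : Matrix ι ι R) :
    matDeriv D (matDeriv E A) = matDeriv E (matDeriv D A) := by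
  ext a b; exact h _

variable [Fintype ι]

lemma matDeriv_mul (D : Derivation ℝ R R) (A B : Matrix ι ι R) :
    matDeriv D (A * B) = matDeriv D A * B + A * matDeriv D B := by
  ext a b
  simp only [matDeriv_apply, Matrix.mul_apply, Matrix.add_apply, map_sum, Derivation.leibniz,
    smul_eq_mul, ← Finset.sum_add_distrib]
  exact Finset.sum_congr rfl fun c _ ↦ by ring

lemma matDeriv_one [DecidableEq ι] (D : Derivation ℝ R R) : matDeriv D (1 : Matrix ι ι R) = 0 := by
  have h := matDeriv_mul D (1 : Matrix ι ι R) 1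
  simpa using h

lemma derivation_trace (D : Derivation ℝ R R) (A : Matrix ι ι R) :
    D A.trace = (matDeriv D A).trace := by
  simp [Matrix.trace]

/-- The curvature matrices `∂ᵢ Γⱼ - ∂ⱼ Γᵢ + [Γᵢ, Γⱼ]` of the connection with matrices `Γ`. -/
def curv (δ : ι → Derivation ℝ R R) (Γ : ι → Matrix ι ι R) (i j : ι) : Matrix ι ι R :=
  matDeriv (δ i) (Γ j) - matDeriv (δ j) (Γ i) + (Γ i * Γ j - Γ j * Γ i)

/-- The Ricci tensor of the connection with matrices `Γ`. -/
def ric (δ : ι → Derivation ℝ R R) (Γ : ι → Matrix ι ι R) : Matrix ι ι R :=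
  Matrix.of fun j k ↦ ∑ i, curv δ Γ i j i k

/-- The Hessian of `f` for the connection with matrices `Γ`. -/
def hess (δ : ι → Derivation ℝ R R) (Γ : ι → Matrix ι ι R) (f : R) : Matrix ι ι R :=
  Matrix.of fun j k ↦ δ j (δ k f) - ∑ l, Γ j l k * δ l f

variable {δ : ι → Derivation ℝ R R} {Γ : ι → Matrix ι ι R} {G J : Matrix ι ι R}

lemma curv_swap (i j : ι) : curv δ Γ j i = -curv δ Γ i j := by
  simp only [curv]; abel

/-- The second Bianchi identity. -/
lemma second_bianchi (hδ : ∀ i j a, δ i (δ j a) = δ j (δ i a)) (i j k : ι) :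
    (matDeriv (δ k) (curv δ Γ i j) + (Γ k * curv δ Γ i j - curv δ Γ i j * Γ k))
    + (matDeriv (δ i) (curv δ Γ j k) + (Γ i * curv δ Γ j k - curv δ Γ j k * Γ i))
    + (matDeriv (δ j) (curv δ Γ k i) + (Γ j * curv δ Γ k i - curv δ Γ k i * Γ j)) = 0 := by
  -- Only the endomorphism part of `∇` appears, so no torsion condition is needed. Second
  -- derivatives cancel because the derivations commute; the rest is Leibniz and Jacobi.
  simp only [curv, map_add, map_sub, matDeriv_mul]
  rw [matDeriv_comm (hδ k i), matDeriv_comm (hδ k j), matDeriv_comm (hδ i j)]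
  noncomm_ring

/-- The first Bianchi identity. -/
lemma first_bianchi (hΓ : ∀ i j k, Γ i k j = Γ j k i) (i j k l : ι) :
    curv δ Γ i j l k + curv δ Γ j k l i + curv δ Γ k i l j = 0 := by
  have h (a b c : ι) : (Γ a * Γ b) l c = (Γ a * Γ c) l b := by
    simp only [Matrix.mul_apply, hΓ b c]
  simp only [curv, Matrix.add_apply, Matrix.sub_apply, matDeriv_apply]
  rw [hΓ j k, hΓ i k, hΓ i j, h i j k, h j i k, h k i j]
  ring

/-- The curvature commutes with a parallel field of endomorphisms. -/
lemma curv_mul_comm (hδ : ∀ i j a, δ i (δ j a) = δ j (δ i a))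
    (hJ : ∀ i, matDeriv (δ i) J = J * Γ i - Γ i * J) (i j : ι) :
    curv δ Γ i j * J = J * curv δ Γ i j := by
  -- The curvature commutator is the integrability condition of `∂ᵢ J = [J, Γᵢ]`.
  have h := matDeriv_comm (hδ i j) J
  simp only [hJ, map_sub, matDeriv_mul] at h
  rw [← sub_eq_zero] at h ⊢
  rw [← neg_eq_zero, ← h, curv]
  noncomm_ring

/-- For a parallel field of endomorphisms `J`, the 2-form `tr (J R(·, ·))` is closed. -/
lemma trace_mul_curv_closed (hδ : ∀ i j a, δ i (δ j a) = δ j (δ i a))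
    (hJ : ∀ i, matDeriv (δ i) J = J * Γ i - Γ i * J) (i j k : ι) :
    δ k (J * curv δ Γ i j).trace + δ i (J * curv δ Γ j k).trace
      + δ j (J * curv δ Γ k i).trace = 0 := by
  -- As `J` is parallel, differentiating `tr (J C)` only hits `C`, covariantly.
  have key (a : ι) (C : Matrix ι ι R) : δ a (J * C).trace
      = (J * (matDeriv (δ a) C + (Γ a * C - C * Γ a))).trace := by
    rw [derivation_trace, matDeriv_mul, hJ]
    have : (Γ a * J * C).trace = (J * C * Γ a).trace := by
      rw [Matrix.mul_assoc, Matrix.trace_mul_comm]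
    simp only [sub_mul, mul_add, mul_sub, Matrix.trace_add, Matrix.trace_sub, this]
    simp only [Matrix.mul_assoc]
    ring
  rw [key, key, key, ← Matrix.trace_add, ← Matrix.trace_add, ← mul_add, ← mul_add,
    second_bianchi hδ, mul_zero, Matrix.trace_zero]

/-- Since `J` commutes with the curvature, it can be moved to the index being traced; the first
Bianchi identity then merges the two curvature terms of the skew part into one. No metric enters. -/
lemma ric_mul_sub (hΓ : ∀ i j k, Γ i k j = Γ j k i)
    (hJ : ∀ i j, curv δ Γ i j * J = J * curv δ Γ i j) (j k : ι) :
    (ric δ Γ * J) j k - (ric δ Γ * J) k j = -(J * curv δ Γ j k).trace := by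
  have h (a b : ι) : (ric δ Γ * J) a b = ∑ i, ∑ l, J i l * curv δ Γ i a l b := by
    have : ∀ i, ∑ l, J i l * curv δ Γ i a l b = ∑ c, curv δ Γ i a i c * J c b := fun i ↦ by
      rw [← Matrix.mul_apply, ← Matrix.mul_apply, hJ]
    simp only [this, Matrix.mul_apply, ric, Matrix.of_apply, Finset.sum_mul]
    exact Finset.sum_comm
  have hs (a b : ι) : curv δ Γ b a = -curv δ Γ a b := curv_swap a b
  simp only [h, Matrix.trace, Matrix.diag, Matrix.mul_apply, ← Finset.sum_sub_distrib,
    ← Finset.sum_neg_distrib]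
  refine Finset.sum_congr rfl fun i _ ↦ Finset.sum_congr rfl fun l _ ↦ ?_
  have hb := first_bianchi (δ := δ) hΓ i j k l
  rw [hs i k, Matrix.neg_apply] at hb
  linear_combination J i l * hb

/-- Parallelism of `J` gives `(∇df)(∂ⱼ, J ∂ₖ) = ∂ⱼ(df(J ∂ₖ)) - df(J ∇ⱼ ∂ₖ)`, whose last term is
symmetric because the torsion vanishes. -/
lemma hess_mul_sub (hΓ : ∀ i j k, Γ i k j = Γ j k i)
    (hJ : ∀ i, matDeriv (δ i) J = J * Γ i - Γ i * J) (f : R) (j k : ι) :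
    (hess δ Γ f * J) j k - (hess δ Γ f * J) k j
      = δ j (∑ a, J a k * δ a f) - δ k (∑ a, J a j * δ a f) := by
  have h (j k : ι) : (hess δ Γ f * J) j k
      = δ j (∑ a, J a k * δ a f) - ∑ a, (J * Γ j) a k * δ a f := by
    have hd (a : ι) : δ j (J a k) = (J * Γ j) a k - (Γ j * J) a k := congrFun₂ (hJ j) a k
    have hs : ∑ x, (∑ l, Γ j l x * δ l f) * J x k = ∑ a, (Γ j * J) a k * δ a f := by
      simp only [Matrix.mul_apply, Finset.sum_mul]
      rw [Finset.sum_comm]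
      exact Finset.sum_congr rfl fun _ _ ↦ Finset.sum_congr rfl fun _ _ ↦ by ring
    rw [Matrix.mul_apply]
    simp only [hess, Matrix.of_apply, sub_mul, Finset.sum_sub_distrib, hs]
    simp only [map_sum, Derivation.leibniz, smul_eq_mul, hd, ← Finset.sum_sub_distrib]
    exact Finset.sum_congr rfl fun _ _ ↦ by ring
  have hs (a : ι) : (J * Γ j) a k = (J * Γ k) a j := by
    simp only [Matrix.mul_apply, hΓ j k]
  rw [h, h]
  simp only [hs]
  ring

/-! ### Kähler structures are parallel -/

lemma eq_zero_of_add_self_eq_zero {x : R} (h : x + x = 0) : x = 0 := by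
  have h2 : (2⁻¹ : ℝ) • (x + x) = x := by
    rw [← two_smul ℝ x, smul_smul]; norm_num
  rw [← h2, h, smul_zero]

/-- A tensor with the symmetries of `g((∇_X J) Y, Z)` on a Kähler manifold vanishes. Here
`a i` is the matrix of `g(∂ⱼ, (∇ᵢJ) ∂ₖ)`. -/
lemma mul_eq_zero_of_kahler_symm {a : ι → Matrix ι ι R} {J : Matrix ι ι R}
    (hanti : ∀ i j k, a i j k = -a i k j) (hcyc : ∀ i j k, a i j k + a j k i + a k i j = 0)
    (hswap : ∀ i, J.transpose * a i = a i * J)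
    (hN : ∀ i m j, ∑ l, J l i * a l m j - ∑ l, J l j * a l m i
      + (a i * J) m j - (a j * J) m i = 0) (i : ι) : a i * J = 0 := by
  set r : ι → ι → ι → R := fun i m j ↦ (a i * J) m j with hr
  have hr1 (i m j : ι) : r i m j = ∑ c, J c j * a i m c := by
    simp only [hr, Matrix.mul_apply, mul_comm]
  have hr2 (i m j : ι) : r i m j = ∑ c, J c m * a i c j := by
    rw [hr]
    change (a i * J) m j = _
    rw [← hswap, Matrix.mul_apply]
    rfl
  have hra (i m j : ι) : r i m j = - r i j m := by
    rw [hr1, hr2, ← Finset.sum_neg_distrib]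
    exact Finset.sum_congr rfl fun c _ ↦ by rw [hanti i m c]; ring
  set p : ι → ι → ι → R := fun i m j ↦ ∑ l, J l i * a l m j with hp
  have hpa (i m j : ι) : p i m j = - p i j m := by
    simp only [hp, ← Finset.sum_neg_distrib]
    exact Finset.sum_congr rfl fun c _ ↦ by rw [hanti c m j]; ring
  have hB (i m j : ι) : p i m j + r i m j = p j m i + r j m i := by
    linear_combination hN i m j
  -- `p + r` is symmetric in its outer indices and skew in its last two. These transpositions are
  -- conjugate in `S₃`, so the signs conflict and `p + r = 0`.
  have hpr (i j m : ι) : p i j m = - r i j m := by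
    refine eq_neg_of_add_eq_zero_left (eq_zero_of_add_self_eq_zero ?_)
    linear_combination hB i j m + hpa m j i + hra m j i - hB m i j - hpa j i m - hra j i m
      + hB j m i + hpa i m j + hra i m j
  -- The cyclic identity with `J` applied to the argument `i` throughout.
  have hc (i j k : ι) : p i j k + r j k i + r k i j = 0 := by
    rw [hr1 j k i, hr2 k i j, hp, ← Finset.sum_add_distrib, ← Finset.sum_add_distrib]
    exact Finset.sum_eq_zero fun c _ ↦ by linear_combination J c i * hcyc c j k
  ext m j
  refine eq_zero_of_add_self_eq_zero ?_
  have h1 := hc m j i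
  have h2 := hc j i m
  rw [hpr] at h1 h2
  change r i m j + r i m j = 0
  linear_combination h1 + h2

/-- A Kähler structure is parallel: `∇J = 0` follows from the vanishing of the Nijenhuis tensor
and of `dω`. -/
lemma complexStructure_parallel [DecidableEq ι] (hΓ : ∀ i j k, Γ i k j = Γ j k i)
    (hG : ∀ i, matDeriv (δ i) G = (Γ i).transpose * G + G * Γ i) (hGu : IsUnit G)
    (hGJ : (G * J).transpose = -(G * J)) (hGs : G.transpose = G) (hJJ : J * J = -1)
    (hN : ∀ k i j, ∑ l, (J l i * δ l (J k j) - J l j * δ l (J k i)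
      - J k l * (δ i (J l j) - δ j (J l i))) = 0)
    (hω : ∀ i j k, δ i ((G * J) j k) + δ j ((G * J) k i) + δ k ((G * J) i j) = 0) (i : ι) :
    matDeriv (δ i) J = J * Γ i - Γ i * J := by
  -- `D i` is the matrix of `∇ᵢJ`. The vanishing of its product with `J` follows once `J² = -1`, `∇g
  -- = 0`, `dω = 0` and `N = 0` are expressed through `D`.
  set D : ι → Matrix ι ι R := fun i ↦ matDeriv (δ i) J + Γ i * J - J * Γ i with hD
  have hDJ (i : ι) : D i * J = -(J * D i) := by
    have h := matDeriv_mul (δ i) J J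
    rw [hJJ, map_neg, matDeriv_one, neg_zero] at h
    have h2 : Γ i * J * J = J * J * Γ i := by rw [Matrix.mul_assoc, hJJ]; simp
    rw [← sub_eq_zero, sub_neg_eq_add]
    calc D i * J + J * D i = (matDeriv (δ i) J * J + J * matDeriv (δ i) J)
          + (Γ i * J * J - J * J * Γ i) := by simp only [hD]; noncomm_ring
      _ = 0 := by rw [← h, h2, sub_self, add_zero]
  have hA (i : ι) : G * D i
      = matDeriv (δ i) (G * J) - (Γ i).transpose * (G * J) - G * J * Γ i := by
    rw [matDeriv_mul, hG, hD]; noncomm_ring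
  have hanti (i : ι) : (G * D i).transpose = -(G * D i) := by
    rw [hA, Matrix.transpose_sub, Matrix.transpose_sub, ← matDeriv_transpose,
      Matrix.transpose_mul _ (G * J), Matrix.transpose_mul _ (Γ i), hGJ,
      Matrix.transpose_transpose, map_neg]
    noncomm_ring
  have hW (i j : ι) : (G * J) i j = - (G * J) j i := congrFun₂ hGJ j i
  have hentry (i j k : ι) : (G * D i) j k = δ i ((G * J) j k)
      - ∑ l, Γ i l j * (G * J) l k + ∑ l, Γ i l k * (G * J) l j := by
    rw [hA, Matrix.sub_apply, Matrix.sub_apply, matDeriv_apply,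
      Matrix.mul_apply (M := (Γ i).transpose), Matrix.mul_apply (M := G * J) (N := Γ i)]
    simp only [hW j _, Matrix.transpose_apply, mul_neg, Finset.sum_neg_distrib, sub_neg_eq_add,
      mul_comm _ (Γ i _ k)]
  -- In the cyclic sum the Christoffel terms cancel in pairs, the torsion being zero.
  have hcyc (i j k : ι) : (G * D i) j k + (G * D j) k i + (G * D k) i j = 0 := by
    simp only [hentry, hΓ j i, hΓ k j, hΓ k i]
    linear_combination hω i j k
  have hswap (i : ι) : J.transpose * (G * D i) = G * D i * J := by
    rw [Matrix.mul_assoc, hDJ, ← Matrix.mul_assoc, ← hGs, ← Matrix.transpose_mul, hGs, hGJ]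
    simp [Matrix.mul_assoc]
  -- For a torsion-free connection, `∂` may be replaced by `∇` in the Nijenhuis tensor.
  have hN' (i k j : ι) : ∑ l, J l i * D l k j - ∑ l, J l j * D l k i
      - (J * D i) k j + (J * D j) k i = 0 := by
    have hs1 : ∑ l, J l i * (Γ l * J) k j = ∑ l, J l j * (Γ l * J) k i := by
      simp only [Matrix.mul_apply, Finset.mul_sum]
      rw [Finset.sum_comm]
      exact Finset.sum_congr rfl fun l _ ↦ Finset.sum_congr rfl fun m _ ↦ by rw [hΓ m l]; ring
    have hs2 (i j : ι) : ∑ l, J l i * (J * Γ l) k j = (J * Γ j * J) k i := by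
      simp only [Matrix.mul_apply (N := J), mul_comm (J _ i)]
      refine Finset.sum_congr rfl fun l _ ↦ ?_
      simp only [Matrix.mul_apply, hΓ l j]
    have hs3 (i j : ι) : (J * D i) k j
        = ∑ l, J k l * δ i (J l j) + (J * Γ i * J) k j + Γ i k j := by
      have : J * D i = J * matDeriv (δ i) J + J * Γ i * J + Γ i := by
        have : J * J * Γ i = -Γ i := by rw [hJJ]; simp
        rw [← sub_neg_eq_add _ (Γ i), ← this, hD]
        noncomm_ring
      rw [this, Matrix.add_apply, Matrix.add_apply, Matrix.mul_apply]
      simp only [matDeriv_apply]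
    have hN1 := hN k i j
    simp only [mul_sub, Finset.sum_sub_distrib] at hN1
    rw [hs3, hs3]
    simp only [hD, Matrix.sub_apply, Matrix.add_apply, matDeriv_apply, mul_add, mul_sub,
      Finset.sum_add_distrib, Finset.sum_sub_distrib, hs2, hs1]
    rw [hΓ i j]
    linear_combination hN1
  have hAJ (i : ι) : G * D i * J = 0 := by
    refine mul_eq_zero_of_kahler_symm (a := fun i ↦ G * D i)
      (fun i j k ↦ congrFun₂ (hanti i) k j) hcyc hswap (fun i m j ↦ ?_) i
    have hl (i j : ι) : ∑ l, J l i * (G * D l) m j = ∑ k, G m k * ∑ l, J l i * D l k j := by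
      simp only [Matrix.mul_apply, Finset.mul_sum]
      rw [Finset.sum_comm]
      exact Finset.sum_congr rfl fun _ _ ↦ Finset.sum_congr rfl fun _ _ ↦ by ring
    have hr (i j : ι) : (G * D i * J) m j = -∑ k, G m k * (J * D i) k j := by
      rw [Matrix.mul_assoc, hDJ, ← Matrix.mul_apply, mul_neg, Matrix.neg_apply]
    have h : ∑ k, G m k * (∑ l, J l i * D l k j - ∑ l, J l j * D l k i
      - (J * D i) k j + (J * D j) k i) = 0 := by simp only [hN', mul_zero, Finset.sum_const_zero]
    simp only [mul_add, mul_sub, Finset.sum_add_distrib, Finset.sum_sub_distrib] at h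
    rw [hl, hl, hr, hr]
    linear_combination h
  have hDi : D i = 0 := by
    have h1 : G * D i = 0 := by
      calc G * D i = -(G * D i * J * J) := by rw [Matrix.mul_assoc _ J J, hJJ]; simp
        _ = 0 := by rw [hAJ]; simp
    exact hGu.mul_right_eq_zero.mp h1
  rw [← sub_eq_zero, ← hDi, hD]
  noncomm_ring

/-- If `Ric + ∇df = λ g` on a Kähler manifold of dimension `m`, then `(m - 2) dλ = 0`. -/
theorem soliton_deriv_eq_zero [DecidableEq ι] (hδ : ∀ i j a, δ i (δ j a) = δ j (δ i a))
    (hΓ : ∀ i j k, Γ i k j = Γ j k i)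
    (hG : ∀ i, matDeriv (δ i) G = (Γ i).transpose * G + G * Γ i) (hGu : IsUnit G)
    (hGJ : (G * J).transpose = -(G * J)) (hGs : G.transpose = G) (hJJ : J * J = -1)
    (hN : ∀ k i j, ∑ l, (J l i * δ l (J k j) - J l j * δ l (J k i)
      - J k l * (δ i (J l j) - δ j (J l i))) = 0)
    (hω : ∀ i j k, δ i ((G * J) j k) + δ j ((G * J) k i) + δ k ((G * J) i j) = 0)
    {f c : R} (h : ric δ Γ + hess δ Γ f = c • G) (i : ι) :
    ((Fintype.card ι : R) - 2) * δ i c = 0 := by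
  have hJ := complexStructure_parallel hΓ hG hGu hGJ hGs hJJ hN hω
  obtain ⟨V, hV, -⟩ := isUnit_iff_exists.mp hGu
  -- The inverse of `G J` is `J⁻¹ G⁻¹ = -J V`.
  have hWV : G * J * (-(J * V)) = 1 := by
    rw [mul_neg, Matrix.mul_assoc, ← Matrix.mul_assoc J, hJJ]
    simp [hV]
  refine eq_zero_of_wedge_eq_zero hGJ hWV (l := fun k ↦ δ k c) (fun i j k ↦ ?_) i
  set α : ι → R := fun k ↦ ∑ a, J a k * δ a f with hα
  have key (j k : ι) : c * (G * J) j k + c * (G * J) j k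
      = -(J * curv δ Γ j k).trace + (δ j (α k) - δ k (α j)) := by
    have h1 (a b : ι) : (ric δ Γ * J) a b + (hess δ Γ f * J) a b = c * (G * J) a b := by
      rw [← Matrix.add_apply, ← add_mul, h, smul_mul_assoc]; rfl
    rw [← ric_mul_sub hΓ (curv_mul_comm hδ hJ), ← hess_mul_sub hΓ hJ f]
    have h2 : (G * J) j k = - (G * J) k j := congrFun₂ hGJ k j
    linear_combination -h1 j k + h1 k j + c * h2
  -- The exterior derivative of `key`: the trace form and `G J` are closed and `d(dα) = 0`, which
  -- leaves twice the wedge of `dc` with `G J`.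
  have d (a j k : ι) := congrArg (δ a) (key j k)
  simp only [map_add, map_sub, map_neg, Derivation.leibniz, smul_eq_mul] at d
  refine eq_zero_of_add_self_eq_zero ?_
  linear_combination d k i j + d i j k + d j k i - trace_mul_curv_closed hδ hJ i j k
    - 2 * c * hω i j k + hδ k i (α j) + hδ i j (α k) + hδ j k (α i)

end DiffMatrix

/-! ### The ring of smooth functions on an open set -/

section SmoothFun

variable {E : Type*} [NormedAddCommGroup E] [NormedSpace ℝ E]

/-- The algebra of smooth functions on a set `U`. -/
def smoothFun (U : Set E) : Subalgebra ℝ (U → ℝ) where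
  carrier := {u | ∃ v : E → ℝ, ContDiffOn ℝ ∞ v U ∧ ∀ x : U, v x = u x}
  mul_mem' := by
    rintro u u' ⟨v, hv, h⟩ ⟨v', hv', h'⟩
    exact ⟨v * v', hv.mul hv', fun x ↦ by simp [h, h']⟩
  add_mem' := by
    rintro u u' ⟨v, hv, h⟩ ⟨v', hv', h'⟩
    exact ⟨v + v', hv.add hv', fun x ↦ by simp [h, h']⟩
  algebraMap_mem' r := ⟨fun _ ↦ r, contDiffOn_const, fun _ ↦ rfl⟩

variable {U : Set E}

/-- The restriction to `U` of a function which is smooth on `U`. -/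
def smoothFun.mk (v : E → ℝ) (hv : ContDiffOn ℝ ∞ v U) : smoothFun U :=
  ⟨fun x ↦ v x, v, hv, fun _ ↦ rfl⟩

namespace smoothFun

/-- An extension of a smooth function on `U`. -/
def extension (u : smoothFun U) : E → ℝ := u.2.choose

lemma contDiffOn_extension (u : smoothFun U) : ContDiffOn ℝ ∞ (extension u) U := u.2.choose_spec.1

lemma extension_apply (u : smoothFun U) (x : U) : (extension u) x = u.1 x := u.2.choose_spec.2 x

/-- On an open set the derivative sees only values inside the set, so derivatives do not depend on
the extension chosen. -/
lemma fderiv_extension_eq (hU : IsOpen U) {u : smoothFun U} {v : E → ℝ} (h : ∀ x : U, u.1 x = v x)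
    {x : E} (hx : x ∈ U) : fderiv ℝ (extension u) x = fderiv ℝ v x := by
  refine Filter.EventuallyEq.fderiv_eq ?_
  filter_upwards [hU.mem_nhds hx] with z hz
  rw [← h ⟨z, hz⟩, ← extension_apply u]

lemma differentiableAt_extension (hU : IsOpen U) (u : smoothFun U) {x : E} (hx : x ∈ U) :
    DifferentiableAt ℝ (extension u) x :=
  ((contDiffOn_extension u).contDiffAt (hU.mem_nhds hx)).differentiableAt (by simp)

lemma _root_.ContDiffOn.fderiv_apply_const {v : E → ℝ} (hv : ContDiffOn ℝ ∞ v U) (hU : IsOpen U)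
    (e : E) : ContDiffOn ℝ ∞ (fun x ↦ fderiv ℝ v x e) U :=
  (hv.fderiv_of_isOpen hU (by simp)).clm_apply contDiffOn_const

/-- The directional derivative along `e`, as a derivation of the ring of smooth functions. -/
def dirDeriv (hU : IsOpen U) (e : E) : Derivation ℝ (smoothFun U) (smoothFun U) :=
  Derivation.mk'
    { toFun := fun u ↦ mk (fun x ↦ fderiv ℝ (extension u) x e)
        ((contDiffOn_extension u).fderiv_apply_const hU e)
      map_add' := fun u v ↦ by
        ext x
        change fderiv ℝ (extension (u + v)) x e
          = fderiv ℝ (extension u) x e + fderiv ℝ (extension v) x e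
        rw [fderiv_extension_eq hU (v := (extension u) + (extension v))
          (fun x ↦ by simp [extension_apply]) x.2,
          fderiv_add (differentiableAt_extension (u := u) hU x.2)
            (differentiableAt_extension (u := v) hU x.2)]
        rfl
      map_smul' := fun r u ↦ by
        ext x
        change fderiv ℝ (extension (r • u)) x e = r • fderiv ℝ (extension u) x e
        rw [fderiv_extension_eq hU (v := r • (extension u))
          (fun x ↦ by simp [extension_apply]) x.2,
          fderiv_const_smul (differentiableAt_extension (u := u) hU x.2)]
        rfl }
    fun u v ↦ by
      ext x
      change fderiv ℝ (extension (u * v)) x e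
        = u.1 x * fderiv ℝ (extension v) x e + v.1 x * fderiv ℝ (extension u) x e
      rw [fderiv_extension_eq hU (v := (extension u) * (extension v))
          (fun x ↦ by simp [extension_apply]) x.2,
          fderiv_mul (differentiableAt_extension (u := u) hU x.2)
            (differentiableAt_extension (u := v) hU x.2),
          ← extension_apply, ← extension_apply]
      rfl

lemma dirDeriv_mk (hU : IsOpen U) (e : E) {v : E → ℝ} (hv : ContDiffOn ℝ ∞ v U) :
    dirDeriv hU e (mk v hv) = mk (fun x ↦ fderiv ℝ v x e) (hv.fderiv_apply_const hU e) := by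
  ext x
  change fderiv ℝ (extension (mk v hv)) x e = fderiv ℝ v x e
  rw [fderiv_extension_eq hU (v := v) (fun _ ↦ rfl) x.2]

lemma mk_extension (u : smoothFun U) : mk (extension u) (contDiffOn_extension u) = u := by
  ext x; exact extension_apply u x

lemma dirDeriv_comm (hU : IsOpen U) (e e' : E) (u : smoothFun U) :
    dirDeriv hU e (dirDeriv hU e' u) = dirDeriv hU e' (dirDeriv hU e u) := by
  rw [← mk_extension u, dirDeriv_mk, dirDeriv_mk, dirDeriv_mk, dirDeriv_mk]
  ext ⟨x, hx⟩
  have hc := (contDiffOn_extension u).contDiffAt (hU.mem_nhds hx)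
  have hd : DifferentiableAt ℝ (fderiv ℝ (extension u)) x :=
    (hc.fderiv_right (m := 1) (by norm_cast)).differentiableAt (by simp)
  have hs := hc.isSymmSndFDerivAt (by simpa using ENat.LEInfty.out)
  change fderiv ℝ (fun x ↦ fderiv ℝ (extension u) x e') x e
    = fderiv ℝ (fun x ↦ fderiv ℝ (extension u) x e) x e'
  rw [fderiv_clm_apply hd (differentiableAt_const _),
    fderiv_clm_apply hd (differentiableAt_const _)]
  simpa using hs.eq e e'

end smoothFun

end SmoothFun

/-! ### Smoothness of determinants and inverse matrices -/

lemma Matrix.contDiffOn_det {E ι : Type*} [NormedAddCommGroup E] [NormedSpace ℝ E] [Fintype ι]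
    [DecidableEq ι] {U : Set E} {G : E → Matrix ι ι ℝ}
    (hG : ∀ i j, ContDiffOn ℝ ∞ (fun y ↦ G y i j) U) : ContDiffOn ℝ ∞ (fun y ↦ (G y).det) U := by
  simp only [Matrix.det_apply]
  exact ContDiffOn.sum fun σ _ ↦ (contDiffOn_prod fun i _ ↦ hG _ _).const_smul _

/-- Cramer's rule: an adjugate entry is the determinant of `G` with one row made constant. -/
lemma Matrix.contDiffOn_inv_apply {E ι : Type*} [NormedAddCommGroup E] [NormedSpace ℝ E]
    [Fintype ι] [DecidableEq ι] {U : Set E} {G : E → Matrix ι ι ℝ}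
    (hG : ∀ i j, ContDiffOn ℝ ∞ (fun y ↦ G y i j) U) (hu : ∀ y ∈ U, IsUnit (G y)) (i j : ι) :
    ContDiffOn ℝ ∞ (fun y ↦ (G y)⁻¹ i j) U := by
  simp only [Matrix.inv_def, Ring.inverse_eq_inv', Matrix.smul_apply, smul_eq_mul,
    Matrix.adjugate_apply]
  refine ((Matrix.contDiffOn_det hG).inv fun y hy ↦ ?_).mul (Matrix.contDiffOn_det fun a b ↦ ?_)
  · exact ((Matrix.isUnit_iff_isUnit_det _).mp (hu y hy)).ne_zero
  · by_cases h : a = j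
    · subst h; simpa using contDiffOn_const
    · simpa [Matrix.updateRow_ne h] using hG a b

/-! ### From the algebraic identity to coordinate domains -/

namespace Coord

open DiffMatrix

variable {n : ℕ} {U : Set (EuclideanSpace ℝ (Fin n))}

lemma contDiffOn_pd (hU : IsOpen U) {v : EuclideanSpace ℝ (Fin n) → ℝ}
    (hv : ContDiffOn ℝ ∞ v U) (i : Fin n) : ContDiffOn ℝ ∞ (pd i v) U :=
  hv.fderiv_apply_const hU _

lemma christoffel_symm {G : EuclideanSpace ℝ (Fin n) → Matrix (Fin n) (Fin n) ℝ}
    (hU : IsOpen U) (hGs : ∀ y ∈ U, (G y).transpose = G y) (k i j : Fin n)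
    {y : EuclideanSpace ℝ (Fin n)} (hy : y ∈ U) :
    christoffel G k i j y = christoffel G k j i y := by
  have (l : Fin n) : pd l (fun z ↦ G z i j) y = pd l (fun z ↦ G z j i) y := by
    refine congrArg (fun L : _ →L[ℝ] ℝ ↦ L (EuclideanSpace.single l 1))
      (Filter.EventuallyEq.fderiv_eq ?_)
    filter_upwards [hU.mem_nhds hy] with z hz
    exact congrFun₂ (hGs z hz) j i
  simp only [christoffel, this]
  congr 1
  exact Finset.sum_congr rfl fun l _ ↦ by ring

/-- The Levi-Civita connection is metric. -/
lemma pd_metric {G : EuclideanSpace ℝ (Fin n) → Matrix (Fin n) (Fin n) ℝ}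
    (hU : IsOpen U) (hGs : ∀ y ∈ U, (G y).transpose = G y) (hGu : ∀ y ∈ U, IsUnit (G y))
    (i j k : Fin n) {y : EuclideanSpace ℝ (Fin n)} (hy : y ∈ U) :
    pd i (fun z ↦ G z j k) y = ∑ l, christoffel G l i j y * G y l k
      + ∑ l, G y j l * christoffel G l i k y := by
  have hs (l a b : Fin n) : pd l (fun z ↦ G z a b) y = pd l (fun z ↦ G z b a) y := by
    refine congrArg (fun L : _ →L[ℝ] ℝ ↦ L (EuclideanSpace.single l 1))
      (Filter.EventuallyEq.fderiv_eq ?_)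
    filter_upwards [hU.mem_nhds hy] with z hz
    exact congrFun₂ (hGs z hz) b a
  -- Lowering the upper index cancels the inverse metric and leaves the Christoffel symbols of the
  -- first kind.
  have hlow (a j k : Fin n) : ∑ l, G y a l * christoffel G l j k y = (1 / 2) *
      (pd j (fun z ↦ G z k a) y + pd k (fun z ↦ G z j a) y - pd a (fun z ↦ G z j k) y) := by
    have hGG : G y * (G y)⁻¹ = 1 :=
      Matrix.mul_nonsing_inv _ ((Matrix.isUnit_iff_isUnit_det _).mp (hGu y hy))
    simp only [christoffel, Finset.mul_sum]
    rw [Finset.sum_comm]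
    have h (m : Fin n) (x : ℝ) : ∑ l, G y a l * (1 / 2 * ((G y)⁻¹ l m * x))
        = 1 / 2 * ((1 : Matrix (Fin n) (Fin n) ℝ) a m * x) := by
      rw [← hGG, Matrix.mul_apply, Finset.sum_mul, Finset.mul_sum]
      exact Finset.sum_congr rfl fun _ _ ↦ by ring
    simp only [h, Matrix.one_apply]
    simp
  have hG (a b : Fin n) : G y a b = G y b a := congrFun₂ (hGs y hy) b a
  simp only [fun l ↦ mul_comm (christoffel G l i j y), hG _ k]
  rw [hlow, hlow, hs i k j]
  ring

/-- If `Ric + ∇df = c g` on a Kähler coordinate domain of dimension at least 4, then `dc = 0`. -/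
theorem pd_eq_zero_of_soliton (hn : 4 ≤ n) (hU : IsOpen U)
    {G J w : EuclideanSpace ℝ (Fin n) → Matrix (Fin n) (Fin n) ℝ}
    {f c : EuclideanSpace ℝ (Fin n) → ℝ}
    (hG : ∀ i j, ContDiffOn ℝ ∞ (fun y ↦ G y i j) U)
    (hJ : ∀ i j, ContDiffOn ℝ ∞ (fun y ↦ J y i j) U)
    (hf : ContDiffOn ℝ ∞ f U) (hc : ContDiffOn ℝ ∞ c U)
    (hGs : ∀ y ∈ U, (G y).transpose = G y) (hGu : ∀ y ∈ U, IsUnit (G y))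
    (hJJ : ∀ y ∈ U, J y * J y = -1) (hherm : ∀ y ∈ U, (J y).transpose * G y * J y = G y)
    (hw : ∀ y ∈ U, w y = (J y).transpose * G y)
    (hN : ∀ y ∈ U, ∀ k i j, nijenhuis J k i j y = 0)
    (hω : ∀ y ∈ U, ∀ i j k, extDerivTwo w i j k y = 0)
    (heq : ∀ y ∈ U, ∀ i j, ricci G i j y + hessian G f i j y = c y * G y i j)
    {y : EuclideanSpace ℝ (Fin n)} (hy : y ∈ U) (i : Fin n) : pd i c y = 0 := by
  have hΓ (k i j : Fin n) : ContDiffOn ℝ ∞ (christoffel G k i j) U := by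
    refine contDiffOn_const.mul (ContDiffOn.sum fun l _ ↦
      (Matrix.contDiffOn_inv_apply hG hGu k l).mul ?_)
    exact ((contDiffOn_pd hU (hG _ _) _).add (contDiffOn_pd hU (hG _ _) _)).sub
      (contDiffOn_pd hU (hG _ _) _)
  set δ : Fin n → Derivation ℝ (smoothFun U) (smoothFun U) :=
    fun i ↦ smoothFun.dirDeriv hU (EuclideanSpace.single i 1) with hδ
  have hδmk (i : Fin n) {v : EuclideanSpace ℝ (Fin n) → ℝ} (hv : ContDiffOn ℝ ∞ v U) :
      δ i (smoothFun.mk v hv) = smoothFun.mk (pd i v) (contDiffOn_pd hU hv i) :=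
    smoothFun.dirDeriv_mk hU _ hv
  set Γ : Fin n → Matrix (Fin n) (Fin n) (smoothFun U) :=
    fun i ↦ Matrix.of fun k j ↦ smoothFun.mk _ (hΓ k i j) with hΓdef
  set G' : Matrix (Fin n) (Fin n) (smoothFun U) :=
    Matrix.of fun i j ↦ smoothFun.mk _ (hG i j) with hG'
  set J' : Matrix (Fin n) (Fin n) (smoothFun U) :=
    Matrix.of fun i j ↦ smoothFun.mk _ (hJ i j) with hJ'
  -- Evaluations at points of `U` are jointly injective, so identities over `smoothFun U` reduce to
  -- pointwise ones.
  set ev : U → smoothFun U →+* ℝ := fun x ↦ (Pi.evalRingHom (fun _ ↦ ℝ) x).comp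
    (smoothFun U).subtype with hev
  have hevmk (x : U) {v : EuclideanSpace ℝ (Fin n) → ℝ} (hv : ContDiffOn ℝ ∞ v U) :
    ev x (smoothFun.mk v hv) = v x := rfl
  have hext {a b : smoothFun U} (h : ∀ x, ev x a = ev x b) : a = b := by
    ext x; exact h x
  have hmext {A B : Matrix (Fin n) (Fin n) (smoothFun U)}
      (h : ∀ x, A.map (ev x) = B.map (ev x)) : A = B := by
    ext i j x; exact congrFun₂ (h x) i j
  have hG'x (x : U) : G'.map (ev x) = G x := rfl
  have hJ'x (x : U) : J'.map (ev x) = J x := rfl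
  -- Hermitian symmetry and `J² = -1` make `J` skew for `g`; hence `w = -G J`.
  have hwG (y) (hy : y ∈ U) : (J y).transpose * G y = -(G y * J y) := by
    nth_rw 2 [← hherm y hy]
    rw [Matrix.mul_assoc _ (J y), hJJ y hy]; simp
  have key := soliton_deriv_eq_zero (δ := δ) (Γ := Γ) (G := G') (J := J')
    (f := smoothFun.mk f hf) (c := smoothFun.mk c hc)
    (fun i j a ↦ smoothFun.dirDeriv_comm hU _ _ a)
    (fun i j k ↦ hext fun x ↦ christoffel_symm hU hGs k i j x.2) ?_ ?_ ?_ ?_ ?_ ?_ ?_ ?_ i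
  · have h := congrArg (ev ⟨y, hy⟩) key
    rw [hδmk, map_mul, hevmk, map_sub, map_natCast, map_ofNat, Fintype.card_fin, map_zero] at h
    have : (4 : ℝ) ≤ n := by exact_mod_cast hn
    exact (mul_eq_zero.mp h).resolve_left (by linarith)
  · intro i
    ext j k : 1
    refine hext fun x ↦ ?_
    simp only [matDeriv_apply, Matrix.add_apply, Matrix.mul_apply, map_add, map_sum, map_mul]
    rw [hG', Matrix.of_apply, hδmk]
    exact pd_metric hU hGs hGu i j k x.2
  · set V : Matrix (Fin n) (Fin n) (smoothFun U) :=
      Matrix.of fun i j ↦ smoothFun.mk _ (Matrix.contDiffOn_inv_apply hG hGu i j) with hV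
    refine IsUnit.of_mul_eq_one V (hmext fun x ↦ ?_)
    rw [Matrix.map_mul, hG'x, Matrix.map_one _ (map_zero _) (map_one _)]
    exact Matrix.mul_nonsing_inv _ ((Matrix.isUnit_iff_isUnit_det _).mp (hGu x x.2))
  · refine hmext fun x ↦ ?_
    rw [Matrix.transpose_map, Matrix.map_neg _ (map_neg _), Matrix.map_mul, hG'x, hJ'x,
      Matrix.transpose_mul, hGs x x.2, hwG x x.2]
  · exact hmext fun x ↦ by rw [Matrix.transpose_map, hG'x, hGs x x.2]
  · refine hmext fun x ↦ ?_
    rw [Matrix.map_mul, hJ'x, hJJ x x.2, Matrix.map_neg _ (map_neg _),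
      Matrix.map_one _ (map_zero _) (map_one _)]
  · intro k i j
    refine hext fun x ↦ ?_
    simp only [hJ', Matrix.of_apply, hδmk, map_sum, map_sub, map_mul, map_zero]
    exact hN x x.2 k i j
  · intro i j k
    have hws (a b : Fin n) : ContDiffOn ℝ ∞ (fun y ↦ w y a b) U := by
      refine ContDiffOn.congr (f := fun y ↦ ∑ c, J y c a * G y c b)
        (ContDiffOn.sum fun c _ ↦ (hJ c a).mul (hG c b)) fun y hy ↦ ?_
      rw [hw y hy, Matrix.mul_apply]; rfl
    have hmk (a b : Fin n) : (G' * J') a b = -smoothFun.mk _ (hws a b) := by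
      refine hext fun x ↦ ?_
      rw [map_neg, hevmk, hw x x.2, hwG x x.2, Matrix.neg_apply, neg_neg, Matrix.mul_apply,
        map_sum]
      simp only [map_mul]
      rfl
    refine hext fun x ↦ ?_
    simp only [hmk, map_neg, hδmk, map_add, map_zero]
    have h := hω x x.2 i j k
    rw [extDerivTwo] at h
    simp only [hevmk]
    linear_combination -h
  · ext j k : 1
    refine hext fun x ↦ ?_
    refine Eq.trans ?_ (heq x x.2 j k)
    simp only [Matrix.add_apply, ric, hess, curv, Matrix.of_apply, Matrix.sub_apply,
      matDeriv_apply, Matrix.mul_apply, map_add, map_sub, map_sum, map_mul, hΓdef, hδmk]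
    simp only [hevmk, ricci, riemann, hessian, Finset.sum_sub_distrib]

end Coord

/-! ### Tensor fields in a chart -/

section Manifold

variable {n : ℕ} {M : Type*} [TopologicalSpace M] [ChartedSpace (EuclideanSpace ℝ (Fin n)) M]
  {e : OpenPartialHomeomorph M (EuclideanSpace ℝ (Fin n))} {y : EuclideanSpace ℝ (Fin n)}

/-- The components of a tangent vector in a chart, as a continuous linear map. -/
def vecCompL (e : OpenPartialHomeomorph M (EuclideanSpace ℝ (Fin n))) (p : M) :
    TangentSpace (𝓡 n) p →L[ℝ] EuclideanSpace ℝ (Fin n) :=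
  (NormedSpace.fromTangentSpace (e p)).toContinuousLinearMap ∘L mfderiv (𝓡 n) (𝓡 n) e p

lemma vecCompL_apply {p : M} (v : TangentSpace (𝓡 n) p) : vecCompL e p v = vecComp e v := rfl

variable [IsManifold (𝓡 n) ∞ M]

lemma mdifferentiable_of_mem_atlas_infty (he : e ∈ atlas (EuclideanSpace ℝ (Fin n)) M) :
    e.MDifferentiable (𝓡 n) (𝓡 n) :=
  have : IsManifold (𝓡 n) 1 M := IsManifold.of_le (n := ∞) ENat.LEInfty.out
  mdifferentiable_of_mem_atlas he

lemma vecCompL_injective (he : e ∈ atlas (EuclideanSpace ℝ (Fin n)) M) {p : M}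
    (hp : p ∈ e.source) : Function.Injective (vecCompL e p) :=
  (NormedSpace.fromTangentSpace (𝕜 := ℝ) (e p)).injective.comp
    ((mdifferentiable_of_mem_atlas_infty he).mfderiv_injective hp)

lemma vecComp_coordVec (he : e ∈ atlas (EuclideanSpace ℝ (Fin n)) M) (hy : y ∈ e.target)
    (i : Fin n) : vecComp e (coordVec e y i) = EuclideanSpace.single i 1 := by
  have h := (mdifferentiable_of_mem_atlas_infty he).comp_symm_deriv hy
  exact congrArg (fun L ↦ L ((NormedSpace.fromTangentSpace y).symm (EuclideanSpace.single i 1))) h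

/-- Both sides have the same components, and components determine a vector because the chart is a
diffeomorphism onto its target. -/
lemma sum_vecComp_smul_coordVec (he : e ∈ atlas (EuclideanSpace ℝ (Fin n)) M) (hy : y ∈ e.target)
    (v : TangentSpace (𝓡 n) (e.symm y)) : ∑ k, vecComp e v k • coordVec e y k = v := by
  refine vecCompL_injective he (e.map_target hy) ?_
  rw [map_sum]
  simp only [map_smul, vecCompL_apply, vecComp_coordVec he hy]
  ext k
  simp [Pi.single_apply]

lemma sum_endoComp_smul_coordVec (he : e ∈ atlas (EuclideanSpace ℝ (Fin n)) M)
    (hy : y ∈ e.target) (J : ∀ p : M, TangentSpace (𝓡 n) p →L[ℝ] TangentSpace (𝓡 n) p)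
    (j : Fin n) :
    ∑ k, endoComp J e y k j • coordVec e y k = J (e.symm y) (coordVec e y j) :=
  sum_vecComp_smul_coordVec he hy _

lemma endoComp_mul_self (he : e ∈ atlas (EuclideanSpace ℝ (Fin n)) M)
    (hy : y ∈ e.target) {J : ∀ p : M, TangentSpace (𝓡 n) p →L[ℝ] TangentSpace (𝓡 n) p}
    (hJ : ∀ (p : M) (v : TangentSpace (𝓡 n) p), J p (J p v) = -v) :
    endoComp J e y * endoComp J e y = -1 := by
  ext k j
  have h := congrArg (fun v ↦ vecCompL e (e.symm y) v k) (hJ (e.symm y) (coordVec e y j))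
  simp only [← sum_endoComp_smul_coordVec he hy J j, map_sum, map_smul, map_neg] at h
  simp only [vecCompL_apply, vecComp_coordVec he hy] at h
  rw [Matrix.mul_apply]
  simpa [endoComp, Matrix.one_apply, Pi.single_apply, mul_comm] using h

lemma metricComp_transpose (g : SmoothMetric n M) : (metricComp g e y).transpose
    = metricComp g e y := by
  ext i j; exact g.symm _ _ _

lemma kahlerFormComp_eq (he : e ∈ atlas (EuclideanSpace ℝ (Fin n)) M) (hy : y ∈ e.target)
    (g : SmoothMetric n M) (J : ∀ p : M, TangentSpace (𝓡 n) p →L[ℝ] TangentSpace (𝓡 n) p) :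
    kahlerFormComp g J e y = (endoComp J e y).transpose * metricComp g e y := by
  ext i j
  simp [kahlerFormComp, ← sum_endoComp_smul_coordVec he hy J i, Matrix.mul_apply, metricComp]

lemma kahlerFormComp_mul_endoComp (he : e ∈ atlas (EuclideanSpace ℝ (Fin n)) M)
    (hy : y ∈ e.target) {g : SmoothMetric n M}
    {J : ∀ p : M, TangentSpace (𝓡 n) p →L[ℝ] TangentSpace (𝓡 n) p}
    (h : ∀ (p : M) (v w : TangentSpace (𝓡 n) p), g.inner p (J p v) (J p w) = g.inner p v w) :
    kahlerFormComp g J e y * endoComp J e y = metricComp g e y := by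
  ext i j
  refine Eq.trans ?_ (h (e.symm y) (coordVec e y i) (coordVec e y j))
  rw [← sum_endoComp_smul_coordVec he hy J j, map_sum, Matrix.mul_apply]
  simp [kahlerFormComp, mul_comm]

lemma isUnit_metricComp (he : e ∈ atlas (EuclideanSpace ℝ (Fin n)) M)
    (hy : y ∈ e.target) (g : SmoothMetric n M) : IsUnit (metricComp g e y) := by
  rw [← Matrix.mulVec_injective_iff_isUnit]
  refine (injective_iff_map_eq_zero (metricComp g e y).mulVecLin).mpr fun x hx ↦ ?_
  -- A kernel vector `x` gives a tangent vector orthogonal to every `∂ᵢ`, hence to itself.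
  set v : TangentSpace (𝓡 n) (e.symm y) := ∑ k, x k • coordVec e y k with hv
  have h1 (i : Fin n) : g.inner (e.symm y) (coordVec e y i) v = 0 := by
    refine Eq.trans ?_ (congrFun hx i)
    simp [hv, Matrix.mulVec, dotProduct, metricComp, mul_comm]
  have h2 : g.inner (e.symm y) v v = 0 := by
    nth_rw 1 [hv]
    simp [h1]
  have h3 : v = 0 := by
    by_contra h
    exact (g.pos _ v h).ne' h2
  ext k
  have h4 := congrArg (fun v ↦ vecCompL e (e.symm y) v k) h3
  simp only [hv, map_sum, map_smul, map_zero] at h4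
  simp only [vecCompL_apply, vecComp_coordVec he hy] at h4
  simpa [Pi.single_apply] using h4

/-- The coordinate field is the tangent map of `e.symm` applied to a constant section. -/
lemma contMDiffOn_coordVec (he : e ∈ atlas (EuclideanSpace ℝ (Fin n)) M) (i : Fin n) :
    ContMDiffOn (𝓡 n) (𝓡 n).tangent ∞ (fun y ↦ (Bundle.TotalSpace.mk' (EuclideanSpace ℝ (Fin n))
      (E := (TangentSpace (𝓡 n) : M → Type _)) (e.symm y) (coordVec e y i))) e.target := by
  have : IsManifold (𝓡 n) 1 M := IsManifold.of_le (n := ∞) ENat.LEInfty.out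
  have h := (contMDiffOn_symm_of_mem_maximalAtlas (I := 𝓡 n) (n := ∞)
    (IsManifold.subset_maximalAtlas he)).contMDiffOn_tangentMapWithin (m := ∞) (by simp)
    e.open_target.uniqueMDiffOn
  have hs : ContMDiffOn (𝓡 n) (𝓡 n).tangent ∞ (fun y : EuclideanSpace ℝ (Fin n) ↦
      (Bundle.TotalSpace.mk' (EuclideanSpace ℝ (Fin n))
      (E := (TangentSpace (𝓡 n) : EuclideanSpace ℝ (Fin n) → Type _)) y
      ((NormedSpace.fromTangentSpace y).symm (EuclideanSpace.single i 1)))) e.target :=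
    contMDiffOn_vectorSpace_iff_contDiffOn.mpr
      (contDiffOn_const (c := EuclideanSpace.single i (1 : ℝ)))
  refine (h.comp hs fun y hy ↦ hy).congr fun y hy ↦ ?_
  simp only [Function.comp, tangentMapWithin, mfderivWithin_of_isOpen e.open_target hy]
  rfl

lemma contDiffOn_metricComp (he : e ∈ atlas (EuclideanSpace ℝ (Fin n)) M) (g : SmoothMetric n M)
    (i j : Fin n) : ContDiffOn ℝ ∞ (fun y ↦ metricComp g e y i j) e.target := by
  have hb := contMDiffOn_symm_of_mem_maximalAtlas (I := 𝓡 n) (n := ∞)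
    (IsManifold.subset_maximalAtlas he)
  intro y hy
  have h := ContMDiffWithinAt.clm_bundle_apply₂ (F₃ := ℝ) (E₃ := Bundle.Trivial M ℝ)
    ((g.contMDiff.comp_contMDiffOn hb) y hy)
    (contMDiffOn_coordVec he i y hy) (contMDiffOn_coordVec he j y hy)
  rw [Bundle.contMDiffWithinAt_totalSpace] at h
  exact h.2.contDiffWithinAt

/-- The tangent map of `e` carries the smooth field `J ∂ⱼ` to the model space, where the fibre
component is smooth. -/
lemma contDiffOn_endoComp (he : e ∈ atlas (EuclideanSpace ℝ (Fin n)) M)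
    {J : ∀ p : M, TangentSpace (𝓡 n) p →L[ℝ] TangentSpace (𝓡 n) p}
    (hJ : IsComplexStructure J) (k j : Fin n) :
    ContDiffOn ℝ ∞ (fun y ↦ endoComp J e y k j) e.target := by
  have : IsManifold (𝓡 n) 1 M := IsManifold.of_le (n := ∞) ENat.LEInfty.out
  have hb := contMDiffOn_symm_of_mem_maximalAtlas (I := 𝓡 n) (n := ∞)
    (IsManifold.subset_maximalAtlas he)
  have h1 := ContMDiffOn.clm_bundle_apply (hJ.smooth.comp_contMDiffOn hb)
    (contMDiffOn_coordVec he j)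
  have h2 := (contMDiffOn_of_mem_maximalAtlas (I := 𝓡 n) (n := ∞)
    (IsManifold.subset_maximalAtlas he)).contMDiffOn_tangentMapWithin (m := ∞) (by simp)
    e.open_source.uniqueMDiffOn
  have h3 := h2.comp h1 fun y hy ↦ e.map_target hy
  have h4 := ((contMDiff_snd_tangentBundle_modelSpace (EuclideanSpace ℝ (Fin n))
    (𝓡 n)).comp_contMDiffOn h3).contDiffOn
  refine ((EuclideanSpace.proj k : _ →L[ℝ] ℝ).contDiff.comp_contDiffOn h4).congr fun y hy ↦ ?_
  simp only [Function.comp, tangentMapWithin,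
    mfderivWithin_of_isOpen e.open_source (e.map_target hy)]
  rfl

lemma ContMDiff.contDiffOn_comp_symm (he : e ∈ atlas (EuclideanSpace ℝ (Fin n)) M) {f : M → ℝ}
    (hf : ContMDiff (𝓡 n) 𝓘(ℝ) ∞ f) : ContDiffOn ℝ ∞ (f ∘ e.symm) e.target :=
  (hf.comp_contMDiffOn (contMDiffOn_symm_of_mem_maximalAtlas (I := 𝓡 n) (n := ∞)
    (IsManifold.subset_maximalAtlas he))).contDiffOn

/-- On a Kähler manifold of dimension at least 4, the metric coefficient of a gradient Ricci almost
soliton is locally constant. -/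
lemma IsGradientRicciAlmostSoliton.isLocallyConstant (hn : 4 ≤ n) {g : SmoothMetric n M}
    {J : ∀ p : M, TangentSpace (𝓡 n) p →L[ℝ] TangentSpace (𝓡 n) p}
    (hK : IsKahler g J) {f lam : M → ℝ} (hsol : IsGradientRicciAlmostSoliton g f lam) :
    IsLocallyConstant lam := by
  rw [IsLocallyConstant.iff_eventually_eq]
  intro p
  set e := chartAt (EuclideanSpace ℝ (Fin n)) p
  have he : e ∈ atlas (EuclideanSpace ℝ (Fin n)) M := chart_mem_atlas _ p
  have hp : p ∈ e.source := mem_chart_source _ p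
  have hpd {y} (hy : y ∈ e.target) (i : Fin n) : Coord.pd i (lam ∘ e.symm) y = 0 :=
    Coord.pd_eq_zero_of_soliton hn e.open_target (contDiffOn_metricComp he g)
      (contDiffOn_endoComp he hK.isComplex) (hsol.smooth_f.contDiffOn_comp_symm he)
      (hsol.smooth_lam.contDiffOn_comp_symm he) (fun y _ ↦ metricComp_transpose g)
      (fun y hy ↦ isUnit_metricComp he hy g)
      (fun y hy ↦ endoComp_mul_self he hy hK.isComplex.sq)
      (fun y hy ↦ by rw [← kahlerFormComp_eq he hy, kahlerFormComp_mul_endoComp he hy hK.hermitian])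
      (fun y hy ↦ kahlerFormComp_eq he hy g J) (hK.isComplex.integrable e he) (hK.closed e he)
      (hsol.eqn e he) hy i
  have hfd {y} (hy : y ∈ e.target) : fderiv ℝ (lam ∘ e.symm) y = 0 := by
    refine ContinuousLinearMap.coe_injective
      ((EuclideanSpace.basisFun (Fin n) ℝ).toBasis.ext fun i ↦ ?_)
    simpa [Coord.pd] using hpd hy i
  -- The chart target may be disconnected, so constancy is obtained on a ball.
  obtain ⟨r, hr, hball⟩ := Metric.isOpen_iff.mp e.open_target (e p) (e.map_source hp)
  have hconst {y} (hy : y ∈ Metric.ball (e p) r) : (lam ∘ e.symm) y = (lam ∘ e.symm) (e p) :=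
    Metric.isOpen_ball.is_const_of_fderiv_eq_zero (convex_ball _ _).isPreconnected
      (((hsol.smooth_lam.contDiffOn_comp_symm he).differentiableOn (by simp)).mono hball)
      (fun z hz ↦ hfd (hball hz)) hy (Metric.mem_ball_self hr)
  filter_upwards [e.open_source.mem_nhds hp,
    (e.continuousAt hp).preimage_mem_nhds (Metric.ball_mem_nhds _ hr)] with q hq hqb
  simpa [e.left_inv hq, e.left_inv hp] using hconst hqb

end Manifold

end

theorem proposition3p1 {n : ℕ} (hn : 4 ≤ n) (hev : Even n)
    {M : Type*} [TopologicalSpace M] [ChartedSpace (EuclideanSpace ℝ (Fin n)) M]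
    [IsManifold (𝓡 n) ∞ M] [PreconnectedSpace M]
    (g : SmoothMetric n M)
    (J : ∀ p : M, TangentSpace (𝓡 n) p →L[ℝ] TangentSpace (𝓡 n) p)
    (hK : IsKahler g J) (f lam : M → ℝ) (hsol : IsGradientRicciAlmostSoliton g f lam) :
    ∃ c : ℝ, (∀ p : M, lam p = c) ∧ IsGradientKahlerRicciSoliton g J f c := by
  have hlc := hsol.isLocallyConstant hn hK
  obtain ⟨c, hc⟩ : ∃ c : ℝ, ∀ p : M, lam p = c := by
    -- `PreconnectedSpace` allows empty `M`; there any constant serves.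
    rcases isEmpty_or_nonempty M with h | ⟨⟨p⟩⟩
    · exact ⟨0, fun p ↦ h.elim p⟩
    · exact ⟨lam p, fun q ↦ hlc.apply_eq_of_preconnectedSpace q p⟩
  obtain rfl : lam = fun _ ↦ c := funext hc
  exact ⟨c, hc, hK, hsol⟩
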